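/- For $n\ge 0$ let $P_n$ be the ordered path with $n$ edges, i.e. the path on the vertices $1<2<\dots<n+1$ whose edges join consecutive vertices; an ordered copy of $P_n$ in an ordered vertex set is an increasing sequence of $n+1$ vertices whose consecutive pairs are edges. In the online game with colors $i\in\{0,\dots,t\}$ on an ordered vertex set, in each turn Builder presents an edge that was not presented before and Painter gives it one of the colors; Builder wins once, for some $i$, there is an ordered copy of $P_{n_i}$ all of whose edges have color $i$. Let $r_o(P_{n_0},\dots,P_{n_t})$ be the minimum number of edges within which Builder can force a win when the vertex set is $\mathbb N$, let $r_o^*(P_{n_0},\dots,P_{n_t})$ be the same number when the vertex set is a fixed ordered set of $1+\prod_{i=0}^t n_i$ vertices, and let $r_o(P_n;t)$ be the value of $r_o$ for the game with $t$ colors in which the path to be forced is $P_n$ in every color. Theorem. For all integers $t\ge 0$ and $n_0,\dots,n_t\ge 1$, both numbers are finite and $$r_o(P_{n_0},\dots,P_{n_t})\le r_o^*(P_{n_0},\dots,P_{n_t})\le n_0\prod_{i=1}^t n_i\left(\lfloor\log_2 n_i\rfloor+1\right).$$ In particular, for every fixed number of colors $t\ge 1$, $r_o(P_n;t)=O\left(n^t(\log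 n)^{t-1}\right)$ as $n\to\infty$. -/

import Mathlib

open Asymptotics Filter

namespace OnlineOrderedRamsey

/-- A position of the online game on the ordered vertex set `V` with colors in `κ`: the set of all
edges played so far together with their colors. The triple `(u, v, c)`, where `u < v`, says
that the edge `uv` has been played and that Painter gave it the color `c`. -/
abbrev Position (V κ : Type*) := Set (V × V × κ)

/-- The edge `uv` has already been played. -/
def Position.Played {V κ : Type*} (S : Position V κ) (u v : V) : Prop :=
  ∃ c : κ, (u, v, c) ∈ S

/-- The position contains an ordered copy in color `c` of the ordered path `P_n` with `n` edges,
that is, vertices `p 0 < p 1 < ⋯ < p n` such that all edges `p j, p (j + 1)` have color `c`. -/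
def Position.HasMonoPath {V κ : Type*} [LinearOrder V] (S : Position V κ) (c : κ) (n : ℕ) : Prop :=
  ∃ p : Fin (n + 1) → V, StrictMono p ∧ ∀ j : Fin n, (p j.castSucc, p j.succ, c) ∈ S

/-- `BuilderForces n m S`: starting from the position `S`, Builder has a strategy which, however
Painter plays, produces within at most `m` further moves a copy of `P_{n c}` in color `c`
for some color `c`. In a move Builder presents an edge `uv` that has not been played before, and
Painter answers with an arbitrary color. -/
def BuilderForces {V κ : Type*} [LinearOrder V] (n : κ → ℕ) : ℕ → Position V κ → Prop
  | 0, S => ∃ c : κ, S.HasMonoPath c (n c)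
  | m + 1, S => (∃ c : κ, S.HasMonoPath c (n c)) ∨
      ∃ u v : V, u < v ∧ ¬ S.Played u v ∧
        ∀ c : κ, BuilderForces n m (insert (u, v, c) S)

/-- The least number of edges within which Builder can force a win in the game on the ordered
vertex set `V`, starting from the empty position; it is `⊤` if there is no such number. -/
noncomputable def gameValue (V : Type*) {κ : Type*} [LinearOrder V] (n : κ → ℕ) : ℕ∞ :=
  ⨅ (m : ℕ) (_ : BuilderForces n m (∅ : Position V κ)), (m : ℕ∞)

/-- The online ordered size Ramsey number `r_o` of the paths `P_{n i}`, `i < k`: the game with `k`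
colors on the vertex set `ℕ`. -/
noncomputable def ro {k : ℕ} (n : Fin k → ℕ) : ℕ∞ :=
  gameValue ℕ n

/-- The number `r_o^*` of the paths `P_{n i}`, `i < k`: the game with `k` colors on a fixed set
of `1 + ∏ i, n i` vertices. -/
noncomputable def roStar {k : ℕ} (n : Fin k → ℕ) : ℕ∞ :=
  gameValue (Fin (1 + ∏ i, n i)) n

/-- The diagonal number `r_o(P_n; t)` with `t` colors. -/
noncomputable def roDiag (n t : ℕ) : ℕ∞ :=
  ro (fun _ : Fin t => n)

end OnlineOrderedRamsey

namespace OnlineOrderedRamsey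

/-! ### Paths ending at a given vertex -/

section Paths

variable {V κ : Type*} [LinearOrder V]

/-! Builder treats the vertices in increasing order and gives each a label: for every color, the
length of some monochromatic path known to end there. Labels are kept distinct. Without a win,
coordinate `c` stays below `n c`, so only `∏ n c` labels exist, one too few for the `1 + ∏ n c`
vertices (`builderForces_fin`). A new label is found by nested search. With one free color `z`, a
single edge suffices (`canReach_searchResult_singleton`); every further color `i` costs a binary
search over its coordinate, a factor `log₂ (n i) + 1` (`canReach_searchResult_of_lt_two_pow`). The
first vertex is free, so `∏ n c` vertices pay this price. -/

/-- The position contains an ordered path with `l` edges in color `c` whose last vertex is `v`. -/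
def Position.PathTo (S : Position V κ) (c : κ) : ℕ → V → Prop
  | 0, _ => True
  | l + 1, v => ∃ u, u < v ∧ (u, v, c) ∈ S ∧ Position.PathTo S c l u

theorem Position.PathTo.mono {S T : Position V κ} (h : S ⊆ T) {c : κ} :
    ∀ {l : ℕ} {v : V}, S.PathTo c l v → T.PathTo c l v
  | 0, _, _ => trivial
  | _ + 1, _, ⟨u, huv, hS, hu⟩ => ⟨u, huv, h hS, hu.mono h⟩

theorem Position.PathTo.of_succ {S : Position V κ} {c : κ} :
    ∀ {l : ℕ} {v : V}, S.PathTo c (l + 1) v → S.PathTo c l v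
  | 0, _, _ => trivial
  | _ + 1, _, ⟨u, huv, hS, hu⟩ => ⟨u, huv, hS, hu.of_succ⟩

theorem Position.PathTo.of_le {S : Position V κ} {c : κ} {l l' : ℕ} {v : V} (hl : l ≤ l')
    (h : S.PathTo c l' v) : S.PathTo c l v := by
  induction l', hl using Nat.le_induction with
  | base => exact h
  | succ k _ ih => exact ih h.of_succ

theorem Position.PathTo.exists_path {S : Position V κ} {c : κ} {l : ℕ} {v : V}
    (h : S.PathTo c l v) :
    ∃ p : Fin (l + 1) → V, StrictMono p ∧ (∀ j : Fin l, (p j.castSucc, p j.succ, c) ∈ S) ∧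
      p (Fin.last l) = v := by
  induction l generalizing v with
  | zero => exact ⟨fun _ => v, Subsingleton.strictMono (α := Fin 1) _, fun j => j.elim0, rfl⟩
  | succ l ih =>
    obtain ⟨u, huv, hS, hu⟩ := h
    obtain ⟨p, hp, hpS, rfl⟩ := ih hu
    refine ⟨Fin.snoc (α := fun _ => V) p v, ?_, ?_, Fin.snoc_last _ _⟩
    · refine Fin.strictMono_iff_lt_succ.2 fun i => ?_
      induction i using Fin.lastCases with
      | last => simpa [Fin.succ_last] using huv
      | cast i =>
        rw [Fin.succ_castSucc, Fin.snoc_castSucc, Fin.snoc_castSucc]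
        exact hp (Fin.castSucc_lt_succ)
    · intro i
      induction i using Fin.lastCases with
      | last => simpa [Fin.succ_last] using hS
      | cast i =>
        rw [Fin.succ_castSucc, Fin.snoc_castSucc, Fin.snoc_castSucc]
        exact hpS i

theorem Position.PathTo.hasMonoPath {S : Position V κ} {c : κ} {l : ℕ} {v : V}
    (h : S.PathTo c l v) : S.HasMonoPath c l :=
  let ⟨p, hp, hpS, _⟩ := h.exists_path
  ⟨p, hp, hpS⟩

end Paths

/-! ### Builder's strategies and their composition -/

section Forcing

variable {V κ : Type*} [LinearOrder V] {n : κ → ℕ}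

theorem BuilderForces.of_hasMonoPath {S : Position V κ} {c : κ} (h : S.HasMonoPath c (n c)) :
    ∀ m, BuilderForces n m S
  | 0 => ⟨c, h⟩
  | _ + 1 => Or.inl ⟨c, h⟩

theorem BuilderForces.succ {m : ℕ} {S : Position V κ} (h : BuilderForces n m S) :
    BuilderForces n (m + 1) S := by
  induction m generalizing S with
  | zero => exact Or.inl h
  | succ m ih =>
    rcases h with h | ⟨u, v, huv, hS, h⟩
    · exact Or.inl h
    · exact Or.inr ⟨u, v, huv, hS, fun c => ih (h c)⟩

theorem BuilderForces.mono {m m' : ℕ} (hm : m ≤ m') {S : Position V κ}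
    (h : BuilderForces n m S) : BuilderForces n m' S := by
  induction m', hm using Nat.le_induction with
  | base => exact h
  | succ k _ ih => exact ih.succ

/-- Asking for an edge that may already be known is harmless. -/
theorem BuilderForces.of_forall_insert {m : ℕ} {S : Position V κ} {u v : V} (huv : u < v)
    (h : ∀ c, BuilderForces n m (insert (u, v, c) S)) : BuilderForces n (m + 1) S := by
  by_cases hS : S.Played u v
  · obtain ⟨c, hc⟩ := hS
    have := h c
    rw [Set.insert_eq_of_mem hc] at this
    exact this.succ
  · exact Or.inr ⟨u, v, huv, hS, h⟩

theorem BuilderForces.image {W : Type*} [LinearOrder W] (e : V ↪o W) {m : ℕ}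
    {S : Position V κ} (h : BuilderForces n m S) :
    BuilderForces n m ((fun x : V × V × κ => (e x.1, e x.2.1, x.2.2)) '' S : Position W κ) := by
  have path : ∀ {T : Position V κ}, (∃ c, T.HasMonoPath c (n c)) →
      ∃ c, Position.HasMonoPath
        ((fun x : V × V × κ => (e x.1, e x.2.1, x.2.2)) '' T : Position W κ) c (n c) := by
    rintro T ⟨c, p, hp, hT⟩
    exact ⟨c, e ∘ p, e.strictMono.comp hp, fun j => ⟨_, hT j, rfl⟩⟩
  induction m generalizing S with
  | zero => exact path h
  | succ m ih =>
    rcases h with h | ⟨u, v, huv, hS, h⟩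
    · exact Or.inl (path h)
    · refine Or.inr ⟨e u, e v, e.strictMono huv, ?_, fun c => ?_⟩
      · rintro ⟨c, ⟨u', v', c'⟩, hx, hxe⟩
        simp only [Prod.mk.injEq, EmbeddingLike.apply_eq_iff_eq] at hxe
        obtain ⟨rfl, rfl, rfl⟩ := hxe
        exact hS ⟨_, hx⟩
      · have := ih (h c)
        rwa [Set.image_insert_eq] at this

theorem gameValue_le_of_orderEmbedding {W : Type*} [LinearOrder W] (e : V ↪o W) (n : κ → ℕ) :
    gameValue W n ≤ gameValue V n := by
  refine le_iInf₂ fun m h => iInf₂_le m ?_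
  simpa using h.image e

/-- From `S`, Builder can within `d` moves either win or reach a position extending `S` that
satisfies `Q`. -/
def CanReach (n : κ → ℕ) (d : ℕ) (S : Position V κ) (Q : Position V κ → Prop) : Prop :=
  ∀ m, (∀ T, S ⊆ T → Q T → BuilderForces n m T) → BuilderForces n (m + d) S

theorem CanReach.of_self {d : ℕ} {S : Position V κ} {Q : Position V κ → Prop} (h : Q S) :
    CanReach n d S Q :=
  fun _ hm => (hm S subset_rfl h).mono (Nat.le_add_right _ _)

theorem CanReach.of_pathTo {d : ℕ} {S : Position V κ} {Q : Position V κ → Prop} {c : κ} {v : V}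
    (h : S.PathTo c (n c) v) : CanReach n d S Q :=
  fun _ _ => .of_hasMonoPath h.hasMonoPath _

theorem CanReach.bind {d d' : ℕ} {S : Position V κ} {Q R : Position V κ → Prop}
    (h : CanReach n d S Q) (h' : ∀ T, S ⊆ T → Q T → CanReach n d' T R) :
    CanReach n (d' + d) S R := by
  intro m hm
  rw [← add_assoc]
  exact h _ fun T hST hT => h' T hST hT m fun U hTU hU => hm U (hST.trans hTU) hU

theorem CanReach.mono {d d' : ℕ} (hd : d ≤ d') {S : Position V κ} {Q R : Position V κ → Prop}
    (h : CanReach n d S Q) (hQR : ∀ T, S ⊆ T → Q T → R T) : CanReach n d' S R :=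
  fun m hm => (h m fun T hST hT => hm T hST (hQR T hST hT)).mono (by omega)

theorem CanReach.edge {S : Position V κ} {u v : V} (huv : u < v) :
    CanReach n 1 S fun T => ∃ c, (u, v, c) ∈ T :=
  fun _ hm => .of_forall_insert huv fun c =>
    hm _ (Set.subset_insert _ _) ⟨c, Set.mem_insert _ _⟩

end Forcing

/-! ### Searching for a new label -/

section Search

variable {V κ : Type*} [LinearOrder V] {n : κ → ℕ}

/-- `ℓ` is a new label for `v`, not used by a smaller vertex, that agrees with `a` outside the set
`s` of colors and whose coordinates in `s` are witnessed by paths ending at `v`. -/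
def IsNewLabel (S : Position V κ) (L : V → κ → ℕ) (v : V) (s : Set κ) (a ℓ : κ → ℕ) : Prop :=
  (∀ c ∉ s, ℓ c = a c) ∧ (∀ c ∈ s, S.PathTo c (ℓ c) v) ∧ ∀ u < v, L u ≠ ℓ

/-- The outcome of a search for the label of `v` among those that agree with `a` outside `s`:
either a new label is found, or some color outside `s` has a path longer than `a` says. -/
def SearchResult (L : V → κ → ℕ) (v : V) (s : Set κ) (a : κ → ℕ) (S : Position V κ) : Prop :=
  (∃ ℓ, IsNewLabel S L v s a ℓ) ∨ ∃ c ∉ s, S.PathTo c (a c + 1) v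

/-- The labels of the vertices below `v` are witnessed by paths. -/
def IsLabeling (S : Position V κ) (L : V → κ → ℕ) (v : V) : Prop :=
  ∀ u < v, ∀ c, S.PathTo c (L u c) u

theorem IsLabeling.mono {S T : Position V κ} (hST : S ⊆ T) {L : V → κ → ℕ} {v : V}
    (h : IsLabeling S L v) : IsLabeling T L v :=
  fun u hu c => (h u hu c).mono hST

/-- Join `v` to a smaller vertex that agrees with `a` off `z` and has maximal `z`-coordinate. Answer
`z` exceeds that maximum by one, so the label is new; any other answer `c` extends a path with `a c`
edges. -/
theorem canReach_searchResult_singleton [Finite V] {S : Position V κ} {L : V → κ → ℕ} {v : V}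
    (hL : IsLabeling S L v) (z : κ) (a : κ → ℕ) :
    CanReach n 1 S (SearchResult L v {z} a) := by
  classical
  by_cases hne : {u : V | u < v ∧ ∀ c, c ≠ z → L u c = a c}.Nonempty
  · obtain ⟨u, ⟨huv, hua⟩, hmax⟩ :=
      Set.exists_max_image _ (fun u => L u z) (Set.toFinite _) hne
    refine (CanReach.edge huv).mono le_rfl ?_
    rintro T hST ⟨c, hc⟩
    have hu := hL.mono hST u huv c
    by_cases hcz : c = z
    · subst hcz
      refine Or.inl ⟨Function.update a c (L u c + 1), ?_, ?_, ?_⟩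
      · intro c' hc'
        exact Function.update_of_ne hc' _ _
      · rintro _ rfl
        rw [Function.update_self]
        exact ⟨u, huv, hc, hu⟩
      · intro w hw hwL
        have h : L w c ≤ L u c := hmax w ⟨hw, fun c' hc' => by rw [hwL, Function.update_of_ne hc']⟩
        have h' : L w c = L u c + 1 := by rw [hwL, Function.update_self]
        omega
    · exact Or.inr ⟨c, hcz, u, huv, hc, hua c hcz ▸ hu⟩
  -- No smaller vertex agrees with `a` off `z`, so coordinate `0` is new without any edge.
  · refine .of_self (Or.inl ⟨Function.update a z 0, ?_, ?_, ?_⟩)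
    · intro c' hc'
      exact Function.update_of_ne hc' _ _
    · rintro _ rfl
      rw [Function.update_self]
      trivial
    · intro w hw hwL
      exact hne ⟨w, hw, fun c' hc' => by rw [hwL, Function.update_of_ne hc']⟩

/-- Binary search for the coordinate of a new color `i`. -/
theorem canReach_searchResult_of_lt_two_pow {L : V → κ → ℕ} {v : V} {s : Set κ} {i : κ}
    (hi : i ∉ s) {d : ℕ}
    (hs : ∀ (S : Position V κ) (a : κ → ℕ), IsLabeling S L v →
      CanReach n d S (SearchResult L v s a))
    (a : κ → ℕ) (q : ℕ) : ∀ (S : Position V κ) (lo up : ℕ), IsLabeling S L v → lo ≤ up →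
      up - lo < 2 ^ q → S.PathTo i lo v →
      (up = n i ∨ ∃ ℓ, ℓ i = up ∧ (∀ c ∉ insert i s, ℓ c = a c) ∧
        (∀ c ∈ s, S.PathTo c (ℓ c) v) ∧ ∀ u < v, L u ≠ ℓ) →
      CanReach n (q * d) S (SearchResult L v (insert i s) a) := by
  classical
  -- The label carried by `up` may lack a path only in color `i`. Once `lo` meets `up`, the path for
  -- `lo` supplies it, or already wins if `up = n i`.
  have done : ∀ (q : ℕ) (S : Position V κ) (lo : ℕ), S.PathTo i lo v →
      (lo = n i ∨ ∃ ℓ, ℓ i = lo ∧ (∀ c ∉ insert i s, ℓ c = a c) ∧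
        (∀ c ∈ s, S.PathTo c (ℓ c) v) ∧ ∀ u < v, L u ≠ ℓ) →
      CanReach n (q * d) S (SearchResult L v (insert i s) a) := by
    rintro q S lo hlo (rfl | ⟨ℓ, rfl, hℓa, hℓs, hℓ⟩)
    · exact .of_pathTo hlo
    · refine .of_self (Or.inl ⟨ℓ, hℓa, ?_, hℓ⟩)
      rintro c (rfl | hc)
      exacts [hlo, hℓs c hc]
  induction q with
  | zero =>
    intro S lo up _ hle hlt hlo hhi
    obtain rfl : lo = up := by rw [pow_zero] at hlt; omega
    exact done 0 S lo hlo hhi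
  | succ q ih =>
    intro S lo up hL hle hlt hlo hhi
    rcases hle.eq_or_lt with rfl | hlt'
    · exact done (q + 1) S lo hlo hhi
    rw [pow_succ] at hlt
    set mid := lo + (up - lo) / 2 with hmid
    rw [Nat.succ_mul]
    -- Fix coordinate `i` at `mid`: a new label lowers `up` to `mid`, a longer path in color `i`
    -- raises `lo` to `mid + 1`, and a longer path in another color ends the search.
    refine (hs S (Function.update a i mid) hL).bind ?_
    rintro T hST (⟨ℓ, hℓa, hℓs, hℓ⟩ | ⟨c, hcs, hc⟩)
    · refine ih T lo mid (hL.mono hST) (by omega) (by omega) (hlo.mono hST)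
        (Or.inr ⟨ℓ, ?_, ?_, hℓs, hℓ⟩)
      · rw [hℓa i ‹_›, Function.update_self]
      · intro c hc
        rw [Set.mem_insert_iff, not_or] at hc
        rw [hℓa c hc.2, Function.update_of_ne hc.1]
    · by_cases hci : c = i
      · subst hci
        rw [Function.update_self] at hc
        refine ih T (mid + 1) up (hL.mono hST) (by omega) (by omega) hc ?_
        refine hhi.imp_right ?_
        rintro ⟨ℓ, h1, h2, h3, h4⟩
        exact ⟨ℓ, h1, h2, fun c hc => (h3 c hc).mono hST, h4⟩
      · rw [Function.update_of_ne hci] at hc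
        exact .of_self (Or.inr ⟨c, by simp [hci, hcs], hc⟩)

theorem canReach_searchResult [Finite V] [DecidableEq κ] {L : V → κ → ℕ} {v : V} (z : κ)
    (s : Finset κ) (hz : z ∉ s) (S : Position V κ) (a : κ → ℕ) (hL : IsLabeling S L v) :
    CanReach n (∏ c ∈ s, (Nat.log 2 (n c) + 1)) S (SearchResult L v (insert z (s : Set κ)) a) := by
  induction s using Finset.induction_on generalizing S a with
  | empty => simpa using canReach_searchResult_singleton hL z a
  | insert i s hi ih =>
    rw [Finset.mem_insert, not_or] at hz
    rw [Finset.prod_insert hi, Finset.coe_insert, Set.insert_comm]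
    have hi' : i ∉ insert z (s : Set κ) := by
      simpa [hi] using Ne.symm hz.1
    exact canReach_searchResult_of_lt_two_pow hi' (fun S a hL => ih hz.2 S a hL) a _ S 0 (n i) hL
      (Nat.zero_le _) (Nat.lt_pow_succ_log_self one_lt_two _) trivial (Or.inl rfl)

/-- Builder can extend an injective labeling to one further vertex. -/
theorem canReach_label [Finite V] [Fintype κ] [DecidableEq κ] (z : κ) {S : Position V κ}
    {L : V → κ → ℕ} {v : V} (hL : IsLabeling S L v) :
    CanReach n (∏ c ∈ Finset.univ.erase z, (Nat.log 2 (n c) + 1)) S fun T =>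
      ∃ ℓ : κ → ℕ, (∀ c, T.PathTo c (ℓ c) v) ∧ ∀ u < v, L u ≠ ℓ := by
  -- All colors are searched, so the reference label `0` is immaterial and no color remains for the
  -- second outcome.
  refine (canReach_searchResult z (Finset.univ.erase z) (by simp) S 0 hL).mono le_rfl ?_
  have huniv : ∀ c, c ∈ insert z ((Finset.univ.erase z : Finset κ) : Set κ) := by
    intro c
    simp
  rintro T _ (⟨ℓ, _, h, h'⟩ | ⟨c, hc, _⟩)
  · exact ⟨ℓ, fun c => h c (huniv c), h'⟩
  · exact absurd (huniv c) hc

theorem canReach_labeling [Fintype κ] [DecidableEq κ] (z : κ) (N k : ℕ) (hk : k ≤ N) :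
    CanReach n (k * ∏ c ∈ Finset.univ.erase z, (Nat.log 2 (n c) + 1))
      (∅ : Position (Fin (1 + N)) κ) fun T => ∃ L : Fin (1 + N) → κ → ℕ,
        (∀ u : Fin (1 + N), u.val ≤ k → ∀ c, T.PathTo c (L u c) u) ∧
        Set.InjOn L {u | u.val ≤ k} := by
  induction k with
  | zero =>
    refine .of_self ⟨0, fun _ _ _ => trivial, fun u hu w hw _ => Fin.ext ?_⟩
    exact (Nat.le_zero.1 hu).trans (Nat.le_zero.1 hw).symm
  | succ k ih =>
    rw [Nat.succ_mul, add_comm (k * _)]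
    refine (ih (by omega)).bind ?_
    rintro S - ⟨L, hL, hinj⟩
    let v : Fin (1 + N) := ⟨k + 1, by omega⟩
    have hlt : ∀ u : Fin (1 + N), u < v ↔ u.val ≤ k := fun u => Nat.lt_succ_iff
    have hor : ∀ u : Fin (1 + N), u.val ≤ k + 1 → u.val ≤ k ∨ u = v := fun u hu => by
      rcases Nat.le_succ_iff.1 hu with h | h
      exacts [Or.inl h, Or.inr (Fin.ext h)]
    have hne : ∀ u : Fin (1 + N), u.val ≤ k → u ≠ v := fun u hu => ((hlt u).2 hu).ne
    refine (canReach_label z (v := v) fun u hu c => hL u ((hlt u).1 hu) c).mono le_rfl ?_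
    rintro T hST ⟨ℓ, hℓ, hnew⟩
    refine ⟨Function.update L v ℓ, fun u hu c => ?_, fun u hu w hw huw => ?_⟩
    · rcases hor u hu with h | rfl
      · rw [Function.update_of_ne (hne u h)]
        exact (hL u h c).mono hST
      · rw [Function.update_self]
        exact hℓ c
    · rcases hor u hu with h | rfl <;> rcases hor w hw with h' | rfl
      · rw [Function.update_of_ne (hne u h), Function.update_of_ne (hne w h')] at huw
        exact hinj h h' huw
      · rw [Function.update_of_ne (hne u h), Function.update_self] at huw
        exact absurd huw (hnew u ((hlt u).2 h))
      · rw [Function.update_of_ne (hne w h'), Function.update_self] at huw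
        exact absurd huw.symm (hnew w ((hlt w).2 h'))
      · rfl

end Search

/-! ### Pigeonhole and the resulting bounds -/

theorem builderForces_fin {κ : Type*} [Fintype κ] [DecidableEq κ] (n : κ → ℕ) (z : κ) :
    BuilderForces n ((∏ c, n c) * ∏ c ∈ Finset.univ.erase z, (Nat.log 2 (n c) + 1))
      (∅ : Position (Fin (1 + ∏ c, n c)) κ) := by
  have h := canReach_labeling (n := n) z (∏ c, n c) _ le_rfl 0
  rw [zero_add] at h
  refine h ?_
  rintro T - ⟨L, hL, hinj⟩
  by_contra hT
  have hle : ∀ u : Fin (1 + ∏ c, n c), u.val ≤ ∏ c, n c := fun u => by omega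
  have hlt : ∀ u c, L u c < n c := fun u c => by
    by_contra! hc
    exact hT ⟨c, ((hL u (hle u) c).of_le hc).hasMonoPath⟩
  have hcard := Fintype.card_le_of_injective
    (fun u (c : κ) => (⟨L u c, hlt u c⟩ : Fin (n c))) fun u w huw =>
      hinj (hle u) (hle w) (funext fun c => congrArg Fin.val (congrFun huw c))
  simp only [Fintype.card_fin, Fintype.card_pi] at hcard
  omega

theorem roStar_le {t : ℕ} (n : Fin (t + 1) → ℕ) :
    roStar n ≤ ((n 0 * ∏ i : Fin t, n i.succ * (Nat.log 2 (n i.succ) + 1) : ℕ) : ℕ∞) := by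
  have h := builderForces_fin n 0
  have he : (∏ c, n c) * ∏ c ∈ Finset.univ.erase 0, (Nat.log 2 (n c) + 1) =
      n 0 * ∏ i : Fin t, n i.succ * (Nat.log 2 (n i.succ) + 1) := by
    have : (Finset.univ.erase 0 : Finset (Fin (t + 1))) =
        Finset.univ.map (Fin.succEmb t) := by
      ext c
      induction c using Fin.cases <;> simp
    rw [this, Finset.prod_map, Fin.prod_univ_succ, mul_assoc, Finset.prod_mul_distrib]
    rfl
  rw [he] at h
  exact iInf₂_le (f := fun (m : ℕ) _ => (m : ℕ∞)) _ h

theorem ro_le_roStar {k : ℕ} (n : Fin k → ℕ) : ro n ≤ roStar n :=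
  gameValue_le_of_orderEmbedding (Fin.valOrderEmb _) n

theorem roDiag_succ_le (n t : ℕ) :
    roDiag n (t + 1) ≤ ((n ^ (t + 1) * (Nat.log 2 n + 1) ^ t : ℕ) : ℕ∞) := by
  refine (ro_le_roStar _).trans ((roStar_le _).trans_eq ?_)
  simp only [Finset.prod_const, Finset.card_univ, Fintype.card_fin]
  rw [mul_pow, pow_succ' n t, mul_assoc]

theorem natLog_two_add_one_le {n : ℕ} (hn : 2 ≤ n) :
    ((Nat.log 2 n + 1 : ℕ) : ℝ) ≤ 2 / Real.log 2 * Real.log n := by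
  have h2 : 0 < Real.log 2 := Real.log_pos one_lt_two
  have hle : (Nat.log 2 n : ℝ) ≤ Real.log n / Real.log 2 := by
    simpa [Real.logb] using Real.natLog_le_logb n 2
  have hone : 1 ≤ Real.log n / Real.log 2 := by
    rw [one_le_div h2]
    exact Real.log_le_log two_pos (by exact_mod_cast hn)
  push_cast
  calc (Nat.log 2 n : ℝ) + 1 ≤ Real.log n / Real.log 2 + Real.log n / Real.log 2 := by linarith
    _ = 2 / Real.log 2 * Real.log n := by ring

theorem roDiag_succ_isBigO (t : ℕ) :
    (fun n : ℕ => ((roDiag n (t + 1)).toNat : ℝ)) =O[atTop]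
      (fun n : ℕ => (n : ℝ) ^ (t + 1) * Real.log (n : ℝ) ^ t) := by
  refine IsBigO.of_bound ((2 / Real.log 2) ^ t) ?_
  filter_upwards [eventually_ge_atTop 2] with n hn
  have hlog : 0 ≤ Real.log n := Real.log_natCast_nonneg n
  rw [Real.norm_of_nonneg (by positivity), Real.norm_of_nonneg (by positivity)]
  have hle : (roDiag n (t + 1)).toNat ≤ n ^ (t + 1) * (Nat.log 2 n + 1) ^ t :=
    ENat.toNat_le_of_le_natCast (roDiag_succ_le n t)
  calc ((roDiag n (t + 1)).toNat : ℝ)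
      ≤ (n : ℝ) ^ (t + 1) * ((Nat.log 2 n + 1 : ℕ) : ℝ) ^ t := by exact_mod_cast hle
    _ ≤ (n : ℝ) ^ (t + 1) * (2 / Real.log 2 * Real.log n) ^ t := by
        gcongr
        exact natLog_two_add_one_le hn
    _ = (2 / Real.log 2) ^ t * ((n : ℝ) ^ (t + 1) * Real.log n ^ t) := by
        rw [mul_pow]; ring

end OnlineOrderedRamsey

theorem theorem3 :
    (∀ (t : ℕ) (n : Fin (t + 1) → ℕ), (∀ i, 1 ≤ n i) →
      OnlineOrderedRamsey.ro n ≤ OnlineOrderedRamsey.roStar n ∧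
      OnlineOrderedRamsey.roStar n ≤
        ((n 0 * ∏ i : Fin t, n i.succ * (⌊Real.logb 2 (n i.succ : ℝ)⌋₊ + 1) : ℕ) : ℕ∞)) ∧
    (∀ t : ℕ, 1 ≤ t →
      (∀ n : ℕ, 1 ≤ n → OnlineOrderedRamsey.roDiag n t ≠ ⊤) ∧
      (fun n : ℕ => ((OnlineOrderedRamsey.roDiag n t).toNat : ℝ)) =O[atTop]
        (fun n : ℕ => (n : ℝ) ^ t * Real.log (n : ℝ) ^ (t - 1))) := by
  refine ⟨fun t n _ => ⟨OnlineOrderedRamsey.ro_le_roStar n, ?_⟩, fun t ht => ?_⟩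
  · have hlog : ∀ i : Fin t, ⌊Real.logb 2 (n i.succ : ℝ)⌋₊ = Nat.log 2 (n i.succ) := fun i => by
      exact_mod_cast Real.natFloor_logb_natCast 2 (n i.succ)
    simp only [hlog]
    exact OnlineOrderedRamsey.roStar_le n
  · obtain ⟨t, rfl⟩ : ∃ s, t = s + 1 := ⟨t - 1, by omega⟩
    exact ⟨fun n _ => ne_top_of_le_ne_top (ENat.natCast_ne_top _)
      (OnlineOrderedRamsey.roDiag_succ_le n t), OnlineOrderedRamsey.roDiag_succ_isBigO t⟩
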